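/- A $d$-branching rooted tree $T^d$ ($d\ge 0$) is the infinite rooted tree in which every node has exactly $d$ children ($T^0$ is a single node). For a simple graph $G$, a homomorphism $\varphi\colon T^d\to G$ is called \emph{cold} if there is a vertex $a$ of $G$ such that for every $k\ge 0$ there is no homomorphism $\psi\colon T^d\to G$ that agrees with $\varphi$ on all nodes at distance $k$ from the root and sends the root to $a$. For $d\ge 2$, $G$ is \emph{$d$-warm} if there is no cold homomorphism $T^{d-2}\to G$, and the \emph{warmth} $w(G)$ is the largest $d$ for which $G$ is $d$-warm ($w(G)=\infty$ if there are arbitrarily large such $d$). Let $G(n,p)$ be the random graph on $n$ labelled vertices in which each pair of vertices is an edge independently with probability $p$. \textbf{Theorem.} Let $\alpha>0$ be a constant and let $p=p(n)\in[0,1]$ satisfy $p=\Omega(n^{-\alpha})$ as $n\to\infty$. Then asymptotically almost surely $$w(G(n,p))\ \ge\ \lceil 1/\alpha+1\rceil,$$ that is, $\Pr\bigl[w(G(n,p))\ge\lceil 1/\alpha+1\rceil\bigr]\to 1$ as $n\to\infty$. -/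

import Mathlib

open Filter Asymptotics

/-- The infinite `d`-branching rooted tree `T^d`. Its nodes are the finite words over a `d`-letter
alphabet; the root is the empty word, and the `d` children of `l` are the words `i :: l`. -/
def branchingTree (d : ℕ) : SimpleGraph (List (Fin d)) where
  Adj l m := (∃ i, m = i :: l) ∨ (∃ i, l = i :: m)
  symm := ⟨fun _ _ h => h.symm⟩
  loopless := ⟨fun l h => by
    rcases h with ⟨i, h⟩ | ⟨i, h⟩ <;> simpa using congrArg List.length h⟩

/-- The root `r` of `T^d`. -/
def branchingRoot (d : ℕ) : List (Fin d) := []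

theorem branchingTree_exists_walk (d : ℕ) (l : List (Fin d)) :
    ∃ w : (branchingTree d).Walk (branchingRoot d) l, w.length = l.length := by
  induction l with
  | nil => exact ⟨SimpleGraph.Walk.nil, rfl⟩
  | cons i l ih =>
    obtain ⟨w, hw⟩ := ih
    have h : (branchingTree d).Adj l (i :: l) := Or.inl ⟨i, rfl⟩
    exact ⟨w.concat h, by
      rw [SimpleGraph.Walk.length_concat, hw, List.length_cons]⟩

theorem branchingTree_length_le (d : ℕ) {l m : List (Fin d)} (w : (branchingTree d).Walk l m) :
    m.length ≤ l.length + w.length := by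
  induction w with
  | nil => simp
  | cons h w ih =>
    rw [SimpleGraph.Walk.length_cons]
    rcases h with ⟨i, rfl⟩ | ⟨i, rfl⟩ <;> rw [List.length_cons] at * <;> omega

/-- The distance of a node from the root is the length of the word. -/
theorem branchingTree_dist_root (d : ℕ) (l : List (Fin d)) :
    (branchingTree d).dist (branchingRoot d) l = l.length := by
  obtain ⟨w, hw⟩ := branchingTree_exists_walk d l
  refine le_antisymm (hw ▸ SimpleGraph.dist_le w) ?_
  obtain ⟨w', hw'⟩ := w.reachable.exists_walk_length_eq_dist
  have := branchingTree_length_le d w'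
  rw [hw'] at this
  simpa [branchingRoot] using this

/-- A homomorphism `φ : T^d → G` is cold if there is a node `a` of `G` such that, for every `k`,
no homomorphism `ψ : T^d → G` agrees with `φ` at distance `k` from the root and maps the root
to `a`. -/
def IsColdMap {V : Type*} {G : SimpleGraph V} {d : ℕ} (φ : branchingTree d →g G) : Prop :=
  ∃ a : V, ∀ k : ℕ, ¬ ∃ ψ : branchingTree d →g G,
    (∀ x, (branchingTree d).dist (branchingRoot d) x = k → ψ x = φ x) ∧ ψ (branchingRoot d) = a

/-- `G` is `d`-warm (for `d ≥ 2`) if there are no cold maps in `Hom(T^(d-2), G)`. -/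
def IsWarm {V : Type*} (G : SimpleGraph V) (d : ℕ) : Prop :=
  2 ≤ d ∧ ∀ φ : branchingTree (d - 2) →g G, ¬ IsColdMap φ

/-- The warmth `w(G)`: the largest `d` for which `G` is `d`-warm; it is `⊤` if there are
arbitrarily large such `d` (for instance if `G` has no edges). -/
noncomputable def warmth {V : Type*} (G : SimpleGraph V) : ℕ∞ :=
  ⨆ (d : ℕ) (_ : IsWarm G d), (d : ℕ∞)

/-! With `m = ⌈1/α + 1⌉ - 2` one has `m * α < 1`, so `n * p ^ m` eventually exceeds any constant
times `(log n)²`. This makes the random graph expanding (`IsExpanding`) with high probability. In an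
expanding graph the possible values at a node, given `φ` some levels below it, gain at least one
vertex per level; after `n` levels every vertex is possible at the root, so no map is cold
(`IsExpanding.isWarm`).

Expansion is a union bound over set sizes `s`, each failing with probability at most `n ^ (-2)`; the
split is at `s = n / l`, where `l` is a constant times `log n`. For small `s`, the vertices outside
the given sets and a candidate common neighbourhood see the sets independently, and Harris'
inequality bounds below the chance of meeting all of them. For large `s`, a failure forces by
pigeonhole two large sets with no edge between them. -/

/-! ### Expansion implies warmth -/

/-- The vertices of `G` that have a neighbour in each of the sets `S i`. -/
def commonNbhd {V : Type*} (G : SimpleGraph V) {m : ℕ} (S : Fin m → Set V) : Set V :=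
  {u | ∀ i, ∃ x ∈ S i, G.Adj u x}

theorem commonNbhd_mono {V : Type*} (G : SimpleGraph V) {m : ℕ} {S T : Fin m → Set V}
    (h : ∀ i, S i ⊆ T i) : commonNbhd G S ⊆ commonNbhd G T := fun _ hu i =>
  let ⟨x, hx, hux⟩ := hu i
  ⟨x, h i hx, hux⟩

/-- Any `m` sets of `s` vertices each, where `0 < s < |V|`, have more than `s` vertices in their
common neighbourhood. -/
def IsExpanding {V : Type*} (G : SimpleGraph V) (m : ℕ) : Prop :=
  ∀ s : ℕ, 1 ≤ s → s < Nat.card V → ∀ S : Fin m → Finset V, (∀ i, (S i).card = s) →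
    s < (commonNbhd G fun i => (S i : Set V)).ncard

/-- The values that a homomorphism from the first `j` levels of the subtree below `x` can take at
`x` if it agrees with `φ` on the last of these levels. -/
def feasible {V : Type*} (G : SimpleGraph V) {m : ℕ} (φ : List (Fin m) → V) :
    ℕ → List (Fin m) → Set V
  | 0, x => {φ x}
  | j + 1, x => commonNbhd G fun i => feasible G φ j (i :: x)

theorem IsExpanding.lt_ncard_commonNbhd {V : Type*} [Finite V] {G : SimpleGraph V} {m : ℕ}
    (h : IsExpanding G m) {s : ℕ} (hs : 1 ≤ s) (hsV : s < Nat.card V) {S : Fin m → Set V}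
    (hS : ∀ i, s ≤ (S i).ncard) : s < (commonNbhd G S).ncard := by
  have : ∀ i, ∃ T : Finset V, (T : Set V) ⊆ S i ∧ T.card = s := fun i => by
    obtain ⟨T, hT, hTs⟩ := Set.exists_subset_card_eq (hS i)
    refine ⟨T.toFinite.toFinset, by simpa using hT, ?_⟩
    rw [← hTs, Set.ncard_eq_toFinset_card]
  choose T hT hTs using this
  exact (h s hs hsV T hTs).trans_le (Set.ncard_le_ncard (commonNbhd_mono G hT))

theorem IsExpanding.le_ncard_feasible {V : Type*} [Finite V] {G : SimpleGraph V} {m : ℕ}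
    (h : IsExpanding G m) (hV : 2 ≤ Nat.card V) (φ : List (Fin m) → V) (j : ℕ) :
    ∀ x, min (Nat.card V) (j + 1) ≤ (feasible G φ j x).ncard := by
  induction j with
  | zero => intro x; simp [feasible]
  | succ j ih =>
    intro x
    -- Expansion needs a size below `|V|`, hence the cap at `|V| - 1`; the strict gain then still
    -- reaches `|V|`.
    have := h.lt_ncard_commonNbhd (s := min (Nat.card V - 1) (j + 1)) (by omega) (by omega)
      (S := fun i => feasible G φ j (i :: x)) fun i => le_trans (by omega) (ih (i :: x))
    rw [feasible]
    omega

/-- A value at the root from which `feasible` sets can be followed down to level `k` extends to a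
homomorphism that agrees with `φ` from level `k` on. -/
theorem exists_hom_of_mem_feasible {V : Type*} {G : SimpleGraph V} {m : ℕ}
    (φ : branchingTree m →g G) (k : ℕ) {a : V} (ha : a ∈ feasible G φ k []) :
    ∃ ψ : branchingTree m →g G, (∀ x, x.length = k → ψ x = φ x) ∧ ψ [] = a := by
  classical
  -- The default value `φ (i :: x)` makes the map coincide with `φ` below level `k`; at level `k`
  -- itself this holds because the feasible set is `{φ x}`.
  let step (i : Fin m) (x : List (Fin m)) (v : V) : V :=
    if hex : x.length < k ∧ ∃ y ∈ feasible G φ (k - (x.length + 1)) (i :: x), G.Adj v y then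
      hex.2.choose else φ (i :: x)
  let f : List (Fin m) → V := fun l => List.rec a (fun i x v => step i x v) l
  have f_cons (i x) : f (i :: x) = step i x (f x) := rfl
  have exists_next (i x) (hx : x.length < k) (hm : f x ∈ feasible G φ (k - x.length) x) :
      ∃ y ∈ feasible G φ (k - (x.length + 1)) (i :: x), G.Adj (f x) y := by
    obtain ⟨j, hj⟩ : ∃ j, k - x.length = j + 1 := ⟨k - x.length - 1, by omega⟩
    rw [hj] at hm
    rw [show k - (x.length + 1) = j by omega]
    exact hm i
  have next_spec (i x) (hx : x.length < k) (hm : f x ∈ feasible G φ (k - x.length) x) :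
      f (i :: x) ∈ feasible G φ (k - (x.length + 1)) (i :: x) ∧ G.Adj (f x) (f (i :: x)) := by
    have hex := exists_next i x hx hm
    have : f (i :: x) = hex.choose := by
      rw [f_cons]
      exact dif_pos ⟨hx, hex⟩
    rw [this]
    exact hex.choose_spec
  have mem (x : List (Fin m)) : x.length ≤ k → f x ∈ feasible G φ (k - x.length) x := by
    induction x with
    | nil => intro _; exact ha
    | cons i x ih => intro hx; exact (next_spec i x hx (ih (Nat.le_of_lt hx))).1
  have agree (x : List (Fin m)) (hx : k ≤ x.length) : f x = φ x := by
    rcases hx.eq_or_lt with hx | hx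
    · have := mem x hx.ge
      rw [← hx, Nat.sub_self] at this
      exact this
    · cases x with
      | nil => simp at hx
      | cons i x =>
        rw [f_cons]
        exact dif_neg fun hex => by simp at hx; omega
  have adj (i x) : G.Adj (f x) (f (i :: x)) := by
    rcases lt_or_ge x.length k with hx | hx
    · exact (next_spec i x hx (mem x hx.le)).2
    · rw [agree x hx, agree (i :: x) (by simp; omega)]
      exact φ.map_adj (Or.inl ⟨i, rfl⟩)
  refine ⟨⟨f, ?_⟩, fun x hx => agree x hx.ge, rfl⟩
  rintro l l' (⟨i, rfl⟩ | ⟨i, rfl⟩)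
  · exact adj i l
  · exact (adj i l').symm

theorem IsExpanding.isWarm {V : Type*} [Finite V] {G : SimpleGraph V} {m : ℕ}
    (h : IsExpanding G m) (hV : 2 ≤ Nat.card V) : IsWarm G (m + 2) := by
  refine ⟨by omega, ?_⟩
  rw [Nat.add_sub_cancel]
  rintro φ ⟨a, ha⟩
  have huniv : feasible G φ (Nat.card V) [] = Set.univ := by
    refine Set.eq_of_subset_of_ncard_le (Set.subset_univ _) ?_
    rw [Set.ncard_univ]
    exact le_trans (by omega) (h.le_ncard_feasible hV φ (Nat.card V) [])
  obtain ⟨ψ, hψ, hψa⟩ := exists_hom_of_mem_feasible φ (Nat.card V) (a := a) (by simp [huniv])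
  refine ha (Nat.card V) ⟨ψ, fun x hx => hψ x ?_, hψa⟩
  rwa [branchingTree_dist_root] at hx

theorem isWarm_two {V : Type*} (G : SimpleGraph V) : IsWarm G 2 := by
  refine ⟨le_rfl, ?_⟩
  rintro φ ⟨a, ha⟩
  -- `T^0` has no node at distance 1, so agreement there is vacuous.
  refine ha 1 ⟨⟨fun _ => a, ?_⟩, fun x hx => ?_, rfl⟩
  · rintro l l' (⟨i, -⟩ | ⟨i, -⟩) <;> exact i.elim0
  · rw [branchingTree_dist_root] at hx
    cases x with
    | nil => simp at hx
    | cons i x => exact i.elim0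

theorem IsWarm.le_warmth {V : Type*} {G : SimpleGraph V} {d : ℕ} (h : IsWarm G d) :
    (d : ℕ∞) ≤ warmth G :=
  le_iSup₂ (f := fun (d : ℕ) (_ : IsWarm G d) => (d : ℕ∞)) d h

/-! ### Independence of edges -/

theorem measurableSet_simpleGraph {V : Type*} [Finite V] (S : Set (SimpleGraph V)) :
    MeasurableSet S := by
  rw [← Set.preimage_image_eq S SimpleGraph.edgeSet_injective]
  refine SimpleGraph.measurable_edgeSet ?_
  rw [← MeasurableEquiv.setOfPred.symm.measurableSet_image]
  exact (Set.toFinite _).measurableSet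

open MeasureTheory ProbabilityTheory in
/-- The edges of the binomial random graph are present independently with probability `p`. -/
theorem binomialRandom_cylinder {V : Type*} [Fintype V] (p : unitInterval) (D : Finset (Sym2 V))
    (hD : ∀ e ∈ D, ¬ e.IsDiag) (b : Sym2 V → Prop) [DecidablePred b] :
    (SimpleGraph.binomialRandom V p).real {G | ∀ e ∈ D, (e ∈ G.edgeSet ↔ b e)} =
      ∏ e ∈ D, if b e then (p : ℝ) else 1 - p := by
  have key : (SimpleGraph.binomialRandom V p) {G | ∀ e ∈ D, (e ∈ G.edgeSet ↔ b e)} =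
      ∏ e ∈ D, ENNReal.ofReal (if b e then (p : ℝ) else 1 - p) := by
    rw [SimpleGraph.binomialRandom_eq_map,
      Measure.map_apply SimpleGraph.measurable_fromEdgeSet (measurableSet_simpleGraph _), setBernoulli_apply']
    have : (fun q : Sym2 V → Prop => {i | q i}) ⁻¹' (SimpleGraph.fromEdgeSet ⁻¹'
        {G | ∀ e ∈ D, (e ∈ G.edgeSet ↔ b e)}) = Set.pi (D : Set (Sym2 V)) fun e => {b e} := by
      ext q
      simp only [Set.mem_preimage, Set.mem_ofPred_eq, Set.mem_pi, Finset.mem_coe,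
        Set.mem_singleton_iff, SimpleGraph.edgeSet_fromEdgeSet]
      refine forall₂_congr fun e he => ?_
      have := hD e he
      simp [this]
    rw [this, Measure.infinitePi_pi]
    · refine Finset.prod_congr rfl fun e he => ?_
      have := hD e he
      by_cases hb : b e
      · simp [hb, this]
        exact (ENNReal.ofReal_coe_nnreal (p := unitInterval.toNNReal p)).symm
      · simp [hb, this]
        exact (ENNReal.ofReal_coe_nnreal (p := unitInterval.toNNReal (unitInterval.symm p))).symm
    · intros; exact .of_discrete
  rw [measureReal_def, key, ENNReal.toReal_prod]
  refine Finset.prod_congr rfl fun e _ => ENNReal.toReal_ofReal ?_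
  split_ifs
  · exact p.2.1
  · linarith [p.2.2]

theorem binomialRandom_no_edges {V : Type*} [Fintype V] (p : unitInterval) (D : Finset (Sym2 V))
    (hD : ∀ e ∈ D, ¬ e.IsDiag) :
    (SimpleGraph.binomialRandom V p).real {G | ∀ e ∈ D, e ∉ G.edgeSet} =
      (1 - p : ℝ) ^ D.card := by
  simpa using binomialRandom_cylinder p D hD fun _ => False

/-! ### Random subsets and Harris' inequality -/

/-- The probability that a `p`-random subset of `W` is `A`. -/
def subsetWeight {V : Type*} (p : ℝ) [DecidableEq V] (W A : Finset V) : ℝ :=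
  p ^ A.card * (1 - p) ^ (W \ A).card

theorem subsetWeight_nonneg {V : Type*} [DecidableEq V] {p : ℝ} (hp0 : 0 ≤ p) (hp1 : p ≤ 1)
    (W A : Finset V) : 0 ≤ subsetWeight p W A :=
  mul_nonneg (pow_nonneg hp0 _) (pow_nonneg (sub_nonneg.2 hp1) _)

theorem subsetWeight_eq_prod {V : Type*} [DecidableEq V] (p : ℝ) {W A : Finset V} (hA : A ⊆ W) :
    subsetWeight p W A = ∏ x ∈ W, if x ∈ A then p else 1 - p := by
  rw [Finset.prod_ite, Finset.prod_const, Finset.prod_const, subsetWeight,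
    Finset.filter_mem_eq_inter, Finset.inter_eq_right.2 hA, Finset.sdiff_eq_filter]

theorem sum_subsetWeight {V : Type*} [DecidableEq V] (p : ℝ) (W : Finset V) :
    ∑ A ∈ W.powerset, subsetWeight p W A = 1 := by
  have := Finset.prod_add (fun _ => p) (fun _ => 1 - p) W
  simpa [subsetWeight] using this.symm

theorem sum_subsetWeight_disjoint {V : Type*} [DecidableEq V] (p : ℝ) {W S : Finset V}
    (hS : S ⊆ W) :
    ∑ A ∈ W.powerset, subsetWeight p W A * (if Disjoint S A then 1 else 0) =
      (1 - p) ^ S.card := by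
  -- Giving the points of `S` inclusion weight 0 kills exactly the terms with `A` meeting `S`.
  have h := Finset.prod_add (fun x => if x ∈ S then 0 else p) (fun _ => 1 - p) W
  have h1 : ∏ x ∈ W, ((if x ∈ S then 0 else p) + (1 - p)) = (1 - p) ^ S.card := by
    rw [← Finset.prod_const, ← Finset.inter_eq_right.2 hS, ← Finset.filter_mem_eq_inter,
      Finset.prod_filter]
    refine Finset.prod_congr rfl fun x hx => ?_
    split_ifs <;> simp_all
  rw [← h1, h]
  refine Finset.sum_congr rfl fun A _ => ?_
  by_cases hd : Disjoint S A
  · rw [if_pos hd, mul_one, subsetWeight, Finset.prod_const]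
    congr 1
    rw [Finset.prod_congr rfl fun x hx => if_neg (Finset.disjoint_right.1 hd hx),
      Finset.prod_const]
  · obtain ⟨x, hxS, hxA⟩ := Finset.not_disjoint_iff.1 hd
    rw [if_neg hd, Finset.prod_eq_zero (f := fun x => if x ∈ S then 0 else p) hxA (if_pos hxS), mul_zero, zero_mul]

/-- Harris' inequality for the events that a random subset of `W` meets the sets `S i`. -/
theorem pow_le_sum_subsetWeight {V κ : Type*} [Fintype V] [DecidableEq V] [DecidableEq κ] {p : ℝ}
    (hp0 : 0 ≤ p) (hp1 : p ≤ 1) (W : Finset V) (S : κ → Finset V) (s : ℕ)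
    (hS : ∀ i, S i ⊆ W) (hs : ∀ i, (S i).card = s) (J : Finset κ) :
    (1 - (1 - p) ^ s) ^ J.card ≤
      ∑ A ∈ W.powerset, subsetWeight p W A * (if ∀ i ∈ J, ¬ Disjoint (S i) A then 1 else 0) := by
  induction J using Finset.induction_on with
  | empty => simp [sum_subsetWeight]
  | insert i J hi ih =>
    -- Extended by zero off the subsets of `W`, the weight lives on the lattice of all finsets,
    -- where `fkg` applies.
    let μ : Finset V → ℝ := fun A => if A ⊆ W then subsetWeight p W A else 0
    let f : Finset V → ℝ := fun A => if ¬ Disjoint (S i) A then 1 else 0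
    let g : Finset V → ℝ := fun A => if ∀ i ∈ J, ¬ Disjoint (S i) A then 1 else 0
    have hsum (F : Finset V → ℝ) :
        ∑ A, μ A * F A = ∑ A ∈ W.powerset, subsetWeight p W A * F A := by
      simp only [μ, ite_mul, zero_mul]
      rw [← Finset.sum_filter]
      congr 1
      ext A
      simp
    have hμ0 : 0 ≤ μ := fun A => by
      simp only [μ]
      split_ifs
      exacts [subsetWeight_nonneg hp0 hp1 W A, le_rfl]
    have hf : Monotone f := fun A B hAB => by
      simp only [f]
      by_cases hB : Disjoint (S i) B
      · simp [hB, hB.mono_right hAB]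
      · simp only [hB, not_false_eq_true, if_true]
        split_ifs <;> norm_num
    have hg : Monotone g := fun A B hAB => by
      simp only [g]
      split_ifs with h1 h2 <;> try norm_num
      exact h2 fun i hi hd => h1 i hi (hd.mono_right hAB)
    -- Inside `W` the weight is a product over points, so equality holds; otherwise the left side
    -- vanishes.
    have hμ (A B : Finset V) : μ A * μ B ≤ μ (A ⊓ B) * μ (A ⊔ B) := by
      by_cases hAB : A ⊆ W ∧ B ⊆ W
      · refine le_of_eq ?_
        have h3 : A ∩ B ⊆ W := Finset.inter_subset_left.trans hAB.1
        have h4 : A ∪ B ⊆ W := Finset.union_subset hAB.1 hAB.2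
        simp only [μ, Finset.inf_eq_inter, Finset.sup_eq_union, if_pos hAB.1, if_pos hAB.2,
          if_pos h3, if_pos h4, subsetWeight_eq_prod p hAB.1, subsetWeight_eq_prod p hAB.2,
          subsetWeight_eq_prod p h3, subsetWeight_eq_prod p h4, ← Finset.prod_mul_distrib]
        refine Finset.prod_congr rfl fun x _ => ?_
        by_cases hA : x ∈ A <;> by_cases hB : x ∈ B <;> simp [hA, hB, mul_comm]
      · refine le_trans (le_of_eq ?_) (mul_nonneg (hμ0 _) (hμ0 _))
        rcases not_and_or.1 hAB with h | h <;> simp [μ, h]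
    have hfkg := fkg (μ := μ) (f := f) (g := g) hμ0
      (fun A => by simp only [f, Pi.zero_apply]; split_ifs <;> simp)
      (fun A => by simp only [g, Pi.zero_apply]; split_ifs <;> simp) hf hg hμ
    have hone : ∑ A, μ A = 1 := by
      have := hsum fun _ => 1
      simpa [sum_subsetWeight] using this
    have hfsum : ∑ A, μ A * f A = 1 - (1 - p) ^ s := by
      rw [hsum, ← hs i, eq_sub_iff_add_eq, ← sum_subsetWeight_disjoint p (hS i),
        ← Finset.sum_add_distrib]
      refine (Finset.sum_congr rfl fun A _ => ?_).trans (sum_subsetWeight p W)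
      by_cases h : Disjoint (S i) A <;> simp [f, h]
    have hfg : ∑ A, μ A * (f A * g A) = ∑ A ∈ W.powerset, subsetWeight p W A *
        (if ∀ j ∈ insert i J, ¬ Disjoint (S j) A then 1 else 0) := by
      rw [hsum]
      refine Finset.sum_congr rfl fun A _ => ?_
      congr 1
      by_cases h : Disjoint (S i) A <;> simp [f, g, h]
    rw [hone, one_mul, hfsum, hsum g, hfg] at hfkg
    rw [Finset.card_insert_of_notMem hi, pow_succ']
    refine le_trans (mul_le_mul_of_nonneg_left ih ?_) hfkg
    exact sub_nonneg.2 (pow_le_one₀ (by linarith) (by linarith))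

/-! ### Few common neighbours: the bound for small sets -/

/-- The neighbourhoods in `W` of the vertices of a set `R` disjoint from `W` are independent
`p`-random subsets of `W`. -/
theorem binomialRandom_nbhd_le {V : Type*} [Fintype V] [DecidableEq V] (p : unitInterval)
    {R W : Finset V} (hRW : Disjoint R W) (Q : Finset V → Prop) [DecidablePred Q] :
    (SimpleGraph.binomialRandom V p).real
      {G | ∀ u ∈ R, ∃ A ∈ W.powerset, Q A ∧ ∀ x ∈ W, (G.Adj u x ↔ x ∈ A)} ≤
      (∑ A ∈ W.powerset, subsetWeight p W A * (if Q A then 1 else 0)) ^ R.card := by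
  classical
  -- Vertices outside `R` get the single dummy choice `∅` with factor 1, so sum and product can be
  -- exchanged over all of `V`.
  let t : V → Finset (Finset V) := fun u => if u ∈ R then W.powerset.filter Q else {∅}
  let g : V → Finset V → ℝ := fun u A => if u ∈ R then subsetWeight p W A else 1
  have hsub : {G : SimpleGraph V | ∀ u ∈ R, ∃ A ∈ W.powerset, Q A ∧ ∀ x ∈ W, (G.Adj u x ↔ x ∈ A)} ⊆
      ⋃ f ∈ Fintype.piFinset t, {G | ∀ u ∈ R, ∀ x ∈ W, (G.Adj u x ↔ x ∈ f u)} := by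
    intro G hG
    choose! A hAW hAQ hA using hG
    simp only [Set.mem_iUnion, Fintype.mem_piFinset]
    refine ⟨fun u => if u ∈ R then A u else ∅, fun u => ?_, fun u hu x hx => ?_⟩
    · by_cases hu : u ∈ R
      · simpa [t, hu] using ⟨Finset.mem_powerset.1 (hAW u hu), hAQ u hu⟩
      · simp [t, hu]
    · simpa [hu] using hA u hu x hx
  have hcyl (f : V → Finset V) (hf : f ∈ Fintype.piFinset t) :
      (SimpleGraph.binomialRandom V p).real {G | ∀ u ∈ R, ∀ x ∈ W, (G.Adj u x ↔ x ∈ f u)} =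
        ∏ u, g u (f u) := by
    -- Disjointness of `R` and `W` makes distinct pairs distinct edges; independence rests on this.
    have hinj : Set.InjOn (fun z : V × V => s(z.1, z.2)) (R ×ˢ W : Finset (V × V)) := by
      rintro ⟨u, x⟩ hux ⟨v, y⟩ hvy h
      simp only [Finset.coe_product, Set.mem_prod, Finset.mem_coe] at hux hvy
      rcases Sym2.eq_iff.1 h with ⟨h1, h2⟩ | ⟨h1, h2⟩
      · simp_all
      · dsimp only at h1
        subst h1
        exact absurd hvy.2 (Finset.disjoint_left.1 hRW hux.1)
    have hb (z : V × V) (hz : z ∈ R ×ˢ W) :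
        (∃ z' ∈ R ×ˢ W, s(z'.1, z'.2) = s(z.1, z.2) ∧ z'.2 ∈ f z'.1) ↔ z.2 ∈ f z.1 := by
      constructor
      · rintro ⟨z', hz', h, h'⟩
        rwa [← hinj hz' hz h]
      · exact fun h => ⟨z, hz, rfl, h⟩
    have := binomialRandom_cylinder p ((R ×ˢ W).image fun z => s(z.1, z.2)) (by
        simp only [Finset.mem_image, Finset.mem_product]
        rintro _ ⟨z, hz, rfl⟩ hd
        rw [Sym2.mk_isDiag_iff] at hd
        exact Finset.disjoint_left.1 hRW hz.1 (hd ▸ hz.2))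
      fun e => ∃ z ∈ R ×ˢ W, s(z.1, z.2) = e ∧ z.2 ∈ f z.1
    rw [Finset.prod_image hinj] at this
    have hset : {G : SimpleGraph V | ∀ u ∈ R, ∀ x ∈ W, (G.Adj u x ↔ x ∈ f u)} =
        {G | ∀ e ∈ (R ×ˢ W).image fun z => s(z.1, z.2),
          (e ∈ G.edgeSet ↔ ∃ z ∈ R ×ˢ W, s(z.1, z.2) = e ∧ z.2 ∈ f z.1)} := by
      ext G
      simp only [Set.mem_ofPred_eq, Finset.forall_mem_image]
      constructor
      · intro h z hz
        rw [hb z hz, SimpleGraph.mem_edgeSet]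
        exact h _ (Finset.mem_product.1 hz).1 _ (Finset.mem_product.1 hz).2
      · intro h u hu x hx
        have hz : (u, x) ∈ R ×ˢ W := Finset.mk_mem_product hu hx
        have := h hz
        rwa [hb _ hz, SimpleGraph.mem_edgeSet] at this
    rw [hset, this, Finset.prod_congr rfl fun z hz => by rw [if_congr (hb z hz) rfl rfl],
      Finset.prod_product]
    simp only [g]
    rw [← Finset.prod_subset (Finset.subset_univ R) fun u _ hu => if_neg hu]
    refine Finset.prod_congr rfl fun u hu => ?_
    have hfu : f u ⊆ W := by
      have := Fintype.mem_piFinset.1 hf u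
      simp only [t, if_pos hu, Finset.mem_filter, Finset.mem_powerset] at this
      exact this.1
    rw [if_pos hu, subsetWeight_eq_prod _ hfu]
  refine (MeasureTheory.measureReal_mono hsub (MeasureTheory.measure_ne_top _ _)).trans ?_
  refine (MeasureTheory.measureReal_biUnion_finset_le _ _).trans ?_
  rw [Finset.sum_congr rfl hcyl, ← Finset.prod_univ_sum]
  have : ∀ u, ∑ A ∈ t u, g u A =
      if u ∈ R then ∑ A ∈ W.powerset, subsetWeight p W A * (if Q A then 1 else 0) else 1 := by
    intro u
    by_cases hu : u ∈ R <;> simp [t, g, hu, Finset.sum_filter]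
  simp [this]

/-- A small common neighbourhood lies in some `T` of size `s`. Each vertex outside `T` and the `S i`
then misses some `S i`, which by Harris has probability at most `1 - (1 - (1 - p) ^ s) ^ m`. The
power of `|V|` counts the choices of the `S i` and `T`. -/
theorem binomialRandom_exists_ncard_commonNbhd_le {V : Type*} [Fintype V] (p : unitInterval)
    (m : ℕ) {s : ℕ} (hsV : s ≤ Fintype.card V) :
    (SimpleGraph.binomialRandom V p).real {G | ∃ S : Fin m → Finset V, (∀ i, (S i).card = s) ∧
        (commonNbhd G fun i => (S i : Set V)).ncard ≤ s} ≤
      (Fintype.card V : ℝ) ^ (s * (m + 1)) *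
        (1 - (1 - (1 - p : ℝ) ^ s) ^ m) ^ (Fintype.card V - (m + 1) * s) := by
  classical
  have hp0 : (0 : ℝ) ≤ p := p.2.1
  have hp1 : (p : ℝ) ≤ 1 := p.2.2
  have hr0 : (0 : ℝ) ≤ (1 - p) ^ s := pow_nonneg (by linarith) _
  have hr1 : (1 - p : ℝ) ^ s ≤ 1 := pow_le_one₀ (by linarith) (by linarith)
  have hq0 : (0 : ℝ) ≤ (1 - (1 - p) ^ s) ^ m := pow_nonneg (by linarith) _
  have hq1 : (1 - (1 - p) ^ s : ℝ) ^ m ≤ 1 := pow_le_one₀ (by linarith) (by linarith)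
  let I := Fintype.piFinset (fun _ : Fin m => Finset.powersetCard s (Finset.univ : Finset V)) ×ˢ
    Finset.powersetCard s (Finset.univ : Finset V)
  let W : (Fin m → Finset V) × Finset V → Finset V := fun z => Finset.univ.biUnion z.1
  let R : (Fin m → Finset V) × Finset V → Finset V := fun z => (W z ∪ z.2)ᶜ
  let E : (Fin m → Finset V) × Finset V → Set (SimpleGraph V) := fun z =>
    {G | ∀ u ∈ R z, ∃ A ∈ (W z).powerset, (¬ ∀ i ∈ Finset.univ, ¬ Disjoint (z.1 i) A) ∧
      ∀ x ∈ W z, (G.Adj u x ↔ x ∈ A)}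
  have hsub : {G : SimpleGraph V | ∃ S : Fin m → Finset V, (∀ i, (S i).card = s) ∧
      (commonNbhd G fun i => (S i : Set V)).ncard ≤ s} ⊆ ⋃ z ∈ I, E z := by
    rintro G ⟨S, hS, hG⟩
    obtain ⟨T, hT, -, hTs⟩ := Finset.exists_subsuperset_card_eq (n := s)
      (Finset.subset_univ (commonNbhd G fun i => (S i : Set V)).toFinset)
      (by rwa [← Set.ncard_eq_toFinset_card']) (by rwa [Finset.card_univ])
    simp only [Set.mem_iUnion]
    refine ⟨(S, T), by simp [I, hS, hTs], fun u hu => ?_⟩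
    refine ⟨(W (S, T)).filter (G.Adj u), by simp, fun h => ?_, fun x hx => by simp [hx]⟩
    simp only [R, Finset.mem_compl, Finset.mem_union, not_or] at hu
    refine hu.2 (hT (Set.mem_toFinset.2 fun i => ?_))
    obtain ⟨x, hx, hxA⟩ := Finset.not_disjoint_iff.1 (h i (Finset.mem_univ i))
    exact ⟨x, hx, (Finset.mem_filter.1 hxA).2⟩
  have hE (z) (hz : z ∈ I) : (SimpleGraph.binomialRandom V p).real (E z) ≤
      (1 - (1 - (1 - p : ℝ) ^ s) ^ m) ^ (Fintype.card V - (m + 1) * s) := by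
    have hz' : (∀ i, (z.1 i).card = s) ∧ z.2.card = s := by simpa [I] using hz
    have hRW : Disjoint (R z) (W z) := by
      refine Finset.disjoint_left.2 fun x hx hxW => ?_
      simp only [R, Finset.mem_compl, Finset.mem_union, not_or] at hx
      exact hx.1 hxW
    have hsum : (∑ A ∈ (W z).powerset, subsetWeight (p : ℝ) (W z) A *
        (if ¬ ∀ i ∈ Finset.univ, ¬ Disjoint (z.1 i) A then 1 else 0)) ≤
          1 - (1 - (1 - p : ℝ) ^ s) ^ m := by
      have h := pow_le_sum_subsetWeight hp0 hp1 (W z) z.1 s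
        (fun i => Finset.subset_biUnion_of_mem z.1 (Finset.mem_univ i)) hz'.1 Finset.univ
      rw [Finset.card_univ, Fintype.card_fin] at h
      refine le_sub_iff_add_le.2 ((add_le_add_right h _).trans (le_of_eq ?_))
      rw [← Finset.sum_add_distrib]
      refine (Finset.sum_congr rfl fun A _ => ?_).trans (sum_subsetWeight (p : ℝ) (W z))
      by_cases hA : ∀ i ∈ Finset.univ, ¬ Disjoint (z.1 i) A
      · rw [if_neg (not_not.2 hA), if_pos hA]; ring
      · rw [if_pos hA, if_neg hA]; ring
    have hsum0 : 0 ≤ ∑ A ∈ (W z).powerset, subsetWeight (p : ℝ) (W z) A *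
        (if ¬ ∀ i ∈ Finset.univ, ¬ Disjoint (z.1 i) A then 1 else 0) :=
      Finset.sum_nonneg fun A _ => mul_nonneg (subsetWeight_nonneg hp0 hp1 _ _) (by
        split_ifs <;> norm_num)
    refine (binomialRandom_nbhd_le p hRW _).trans ?_
    refine (pow_le_pow_left₀ hsum0 hsum _).trans ?_
    refine pow_le_pow_of_le_one (by linarith) (by linarith) ?_
    have h1 : (W z).card ≤ m * s := by
      refine Finset.card_biUnion_le.trans ?_
      simp [hz'.1]
    have h2 := Finset.card_union_le (W z) z.2
    simp only [R, Finset.card_compl]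
    rw [hz'.2] at h2
    have : (m + 1) * s = m * s + s := by ring
    omega
  refine (MeasureTheory.measureReal_mono hsub (MeasureTheory.measure_ne_top _ _)).trans ?_
  refine (MeasureTheory.measureReal_biUnion_finset_le _ _).trans ?_
  refine (Finset.sum_le_card_nsmul _ _ _ hE).trans ?_
  rw [nsmul_eq_mul]
  refine mul_le_mul_of_nonneg_right ?_ (pow_nonneg (by linarith) _)
  have : I.card ≤ Fintype.card V ^ (s * (m + 1)) := by
    simp only [I, Finset.card_product, Fintype.card_piFinset, Finset.card_powersetCard,
      Finset.card_univ, Finset.prod_const, Fintype.card_fin]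
    rw [← pow_succ, pow_mul]
    exact Nat.pow_le_pow_left (Nat.choose_le_pow _ _) _
  exact_mod_cast this

/-! ### Pairs of sets without edges: the bound for large sets -/

/-- `S` and `T` may overlap: the diagonal takes at most `|T|`, hence at most half, of the pairs, and
each edge comes from at most two ordered pairs. -/
theorem mul_le_four_mul_card_image_sym2 {V : Type*} [DecidableEq V] {S : Finset V} (T : Finset V)
    (hS : 2 ≤ S.card) :
    S.card * T.card ≤
      4 * (((S ×ˢ T).filter fun z => z.1 ≠ z.2).image fun z => s(z.1, z.2)).card := by
  have h1 : ((S ×ˢ T).filter fun z => z.1 ≠ z.2).card ≤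
      2 * (((S ×ˢ T).filter fun z => z.1 ≠ z.2).image fun z => s(z.1, z.2)).card := by
    refine Finset.card_le_mul_card_image _ _ fun e he => ?_
    obtain ⟨z, -, rfl⟩ := Finset.mem_image.1 he
    refine (Finset.card_le_card (t := {z, z.swap}) fun w hw => ?_).trans Finset.card_le_two
    rcases Sym2.eq_iff.1 (Finset.mem_filter.1 hw).2 with h | h
    · simp [Prod.ext_iff, h]
    · simp [Prod.ext_iff, h]
  have h2 : ((S ×ˢ T).filter fun z => z.1 = z.2).card ≤ T.card := by
    refine Finset.card_le_card_of_injOn Prod.snd (fun z hz => ?_) fun z hz w hw h => ?_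
    · simp at hz ⊢
      exact hz.1.2
    · simp at hz hw
      exact Prod.ext (hz.2.trans (h.trans hw.2.symm)) h
  have h3 := Finset.card_filter_add_card_filter_not (s := S ×ˢ T) fun z => z.1 = z.2
  rw [Finset.card_product] at h3
  simp only [ne_eq] at h1 ⊢
  nlinarith [Nat.mul_le_mul_right T.card hS]

/-- The binomial coefficient is kept because `s` may be close to `|V|`, where `|V| ^ s` would be too
wasteful. -/
theorem binomialRandom_exists_no_edges_le {V : Type*} [Fintype V] (p : unitInterval) {s : ℕ}
    (hs : 2 ≤ s) (t : ℕ) :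
    (SimpleGraph.binomialRandom V p).real {G | ∃ S T : Finset V, S.card = s ∧ T.card = t ∧
        ∀ x ∈ S, ∀ y ∈ T, ¬ G.Adj x y} ≤
      (Fintype.card V).choose s * (Fintype.card V : ℝ) ^ t * Real.exp (-(p * s * t / 4)) := by
  classical
  have hp0 : (0 : ℝ) ≤ p := p.2.1
  have hp1 : (p : ℝ) ≤ 1 := p.2.2
  let I := Finset.powersetCard s (Finset.univ : Finset V) ×ˢ
    Finset.powersetCard t (Finset.univ : Finset V)
  let D : Finset V × Finset V → Finset (Sym2 V) := fun z =>
    ((z.1 ×ˢ z.2).filter fun w => w.1 ≠ w.2).image fun w => s(w.1, w.2)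
  have hsub : {G : SimpleGraph V | ∃ S T : Finset V, S.card = s ∧ T.card = t ∧
      ∀ x ∈ S, ∀ y ∈ T, ¬ G.Adj x y} ⊆ ⋃ z ∈ I, {G | ∀ e ∈ D z, e ∉ G.edgeSet} := by
    rintro G ⟨S, T, hS, hT, h⟩
    simp only [Set.mem_iUnion]
    refine ⟨(S, T), by simp [I, hS, hT], fun e he => ?_⟩
    obtain ⟨w, hw, rfl⟩ := Finset.mem_image.1 he
    obtain ⟨hw, -⟩ := Finset.mem_filter.1 hw
    exact h _ (Finset.mem_product.1 hw).1 _ (Finset.mem_product.1 hw).2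
  have hE (z) (hz : z ∈ I) :
      (SimpleGraph.binomialRandom V p).real {G | ∀ e ∈ D z, e ∉ G.edgeSet} ≤
        Real.exp (-(p * s * t / 4)) := by
    have hz' : z.1.card = s ∧ z.2.card = t := by simpa [I] using hz
    rw [binomialRandom_no_edges]
    · have h4 : (s * t : ℝ) ≤ 4 * (D z).card := by
        have := mul_le_four_mul_card_image_sym2 z.2 (hz'.1 ▸ hs)
        rw [hz'.1, hz'.2] at this
        exact_mod_cast this
      calc (1 - p : ℝ) ^ (D z).card ≤ Real.exp (-p) ^ (D z).card :=
            pow_le_pow_left₀ (by linarith) (Real.one_sub_le_exp_neg _) _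
        _ = Real.exp (-(p * (D z).card)) := by rw [← Real.exp_nat_mul]; ring_nf
        _ ≤ _ := Real.exp_le_exp.2 (by nlinarith)
    · intro e he
      obtain ⟨w, hw, rfl⟩ := Finset.mem_image.1 he
      rw [Sym2.mk_isDiag_iff]
      exact (Finset.mem_filter.1 hw).2
  refine (MeasureTheory.measureReal_mono hsub (MeasureTheory.measure_ne_top _ _)).trans ?_
  refine (MeasureTheory.measureReal_biUnion_finset_le _ _).trans ?_
  refine (Finset.sum_le_card_nsmul _ _ _ hE).trans ?_
  rw [nsmul_eq_mul]
  refine mul_le_mul_of_nonneg_right ?_ (Real.exp_pos _).le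
  have : I.card ≤ (Fintype.card V).choose s * Fintype.card V ^ t := by
    simp only [I, Finset.card_product, Finset.card_powersetCard, Finset.card_univ]
    exact Nat.mul_le_mul_left _ (Nat.choose_le_pow _ _)
  exact_mod_cast this

/-- More than `m * (t - 1)` vertices have no neighbour in some `S i`; by pigeonhole one index
accounts for `t` of them. -/
theorem exists_no_edges_of_ncard_commonNbhd_le {V : Type*} [Fintype V] {G : SimpleGraph V}
    {m s t : ℕ} {S : Fin m → Finset V} (hS : ∀ i, (S i).card = s)
    (h : (commonNbhd G fun i => (S i : Set V)).ncard ≤ s) (ht : m * (t - 1) + s < Fintype.card V) :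
    ∃ S T : Finset V, S.card = s ∧ T.card = t ∧ ∀ x ∈ S, ∀ y ∈ T, ¬ G.Adj x y := by
  classical
  let B : Fin m → Finset V := fun i => Finset.univ.filter fun u => ∀ x ∈ S i, ¬ G.Adj x u
  have hcover : (commonNbhd G fun i => (S i : Set V)).toFinset ∪ Finset.univ.biUnion B =
      Finset.univ := by
    refine Finset.eq_univ_of_forall fun u => ?_
    rw [Finset.mem_union, or_iff_not_imp_left, Set.mem_toFinset]
    intro hu
    simp only [commonNbhd, Set.mem_ofPred_eq, not_forall] at hu
    obtain ⟨i, hi⟩ := hu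
    refine Finset.mem_biUnion.2 ⟨i, Finset.mem_univ i, ?_⟩
    simp only [B, Finset.mem_filter, Finset.mem_univ, true_and]
    exact fun x hx hxu => hi ⟨x, hx, hxu.symm⟩
  have hcard := (Finset.card_union_le _ _).trans' (congrArg Finset.card hcover).ge
  rw [Finset.card_univ, ← Set.ncard_eq_toFinset_card'] at hcard
  have hex : ∃ i, t ≤ (B i).card := by
    by_contra! hlt
    have : (Finset.univ.biUnion B).card ≤ m * (t - 1) := by
      refine (Finset.card_biUnion_le_card_mul _ _ (t - 1) fun i _ => ?_).trans (by simp)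
      have := hlt i
      omega
    omega
  obtain ⟨i, hi⟩ := hex
  obtain ⟨T, hT, hTt⟩ := Finset.exists_subset_card_eq hi
  exact ⟨S i, T, hS i, hTt, fun x hx y hy => (Finset.mem_filter.1 (hT hy)).2 x hx⟩

/-! ### Quantitative failure probabilities -/

/-- Bernoulli and `(1 - p) * (1 + p) ≤ 1` give `(1 - p) ^ s ≤ 1 / (1 + s * p)`. -/
theorem min_div_two_le_one_sub_pow {p : ℝ} (hp0 : 0 ≤ p) (hp1 : p ≤ 1) (s : ℕ) :
    min (s * p) 1 / 2 ≤ 1 - (1 - p) ^ s := by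
  have h : (1 - p) ^ s * (1 + s * p) ≤ 1 := by
    calc (1 - p) ^ s * (1 + s * p) ≤ (1 - p) ^ s * (1 + p) ^ s :=
          mul_le_mul_of_nonneg_left (one_add_mul_le_pow (by linarith) s) (by
            exact pow_nonneg (by linarith) _)
      _ = (1 - p ^ 2) ^ s := by rw [← mul_pow]; ring
      _ ≤ 1 := pow_le_one₀ (by nlinarith) (by nlinarith)
  have hr : 0 ≤ (1 - p) ^ s := pow_nonneg (by linarith) _
  have hsp : 0 ≤ s * p := by positivity
  rcases le_total (s * p) 1 with h1 | h1
  · rw [min_eq_left h1]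
    have : (1 - p) ^ s * (1 + s * p) ≤ (1 - s * p / 2) * (1 + s * p) := by nlinarith
    have := le_of_mul_le_mul_right this (by linarith)
    linarith
  · rw [min_eq_right h1]
    nlinarith

/-- The failure probability of the expansion at sets of size `s`, for small `s`. -/
theorem binomialRandom_small_sets_le {V : Type*} [Fintype V] (p : unitInterval) {m : ℕ}
    {L l : ℝ} (hL : L = Real.log (Fintype.card V)) (hL1 : 1 ≤ L) (hl : l = 2 ^ (m + 2) * (m + 3) * L)
    (hp : l ^ 2 ≤ Fintype.card V * (p : ℝ) ^ m) (hm : 1 ≤ m) {s : ℕ} (hs : 1 ≤ s)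
    (hsl : s * l ≤ Fintype.card V) :
    (SimpleGraph.binomialRandom V p).real {G | ∃ S : Fin m → Finset V, (∀ i, (S i).card = s) ∧
        (commonNbhd G fun i => (S i : Set V)).ncard ≤ s} ≤ Real.exp (-(2 * L)) := by
  set n := Fintype.card V with hn
  have hp0 : (0 : ℝ) ≤ p := p.2.1
  have hp1 : (p : ℝ) ≤ 1 := p.2.2
  have hs' : (1 : ℝ) ≤ s := by exact_mod_cast hs
  have hn0 : (0 : ℝ) < n := by
    refine Nat.cast_pos.2 (Nat.pos_of_ne_zero fun h => ?_)
    rw [h, Nat.cast_zero, Real.log_zero] at hL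
    linarith
  have hpow : (1 : ℝ) ≤ 2 ^ m := one_le_pow₀ (by norm_num)
  have hm0 : (0 : ℝ) ≤ m := by positivity
  have hlm : 4 * (m + 3) ≤ l := by
    rw [hl, pow_add]
    nlinarith [mul_nonneg (sub_nonneg.2 hpow) (sub_nonneg.2 hL1), mul_nonneg hm0 (sub_nonneg.2 hpow),
      mul_nonneg (mul_nonneg hm0 (sub_nonneg.2 hpow)) (sub_nonneg.2 hL1),
      mul_nonneg hm0 (sub_nonneg.2 hL1)]
  have hsn : 2 * ((m + 1) * s : ℝ) ≤ n := by nlinarith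
  have hsn' : (m + 1) * s ≤ n := by
    have : ((m + 1) * s : ℝ) ≤ n := by nlinarith
    exact_mod_cast this
  set q : ℝ := 1 - (1 - p) ^ s with hq
  have hqmin := min_div_two_le_one_sub_pow hp0 hp1 s
  rw [← hq] at hqmin
  have hq1 : q ≤ 1 := by
    have : (0 : ℝ) ≤ (1 - p) ^ s := pow_nonneg (by linarith) _
    linarith
  -- The exponent must pay `(m + 1) * s * L` for the choices of sets and `2 * L` for the target; `n
  -- / 2` bounds the number of remaining vertices.
  have hkey : (m + 3) * s * L ≤ q ^ m * (n / 2) := by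
    have h2 : (2 : ℝ) ^ (m + 1) * ((m + 3) * s * L) = s * l / 2 := by rw [hl]; ring
    have h3 : s * l / 2 ≤ 2 ^ (m + 1) * (q ^ m * (n / 2)) := by
      have h4 : (2 : ℝ) ^ (m + 1) * (q ^ m * (n / 2)) = (2 * q) ^ m * n := by
        rw [mul_pow, pow_succ]; ring
      rw [h4]
      -- If `s * p ≤ 1`, the bound comes from `n * p ^ m ≥ l ^ 2` and `s ^ m ≥ s`; otherwise `2 * q
      -- ≥ 1` and `s * l ≤ n` suffices.
      rcases le_total (s * p : ℝ) 1 with h1 | h1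
      · rw [min_eq_left h1] at hqmin
        have h5 : (s * p : ℝ) ^ m ≤ (2 * q) ^ m :=
          pow_le_pow_left₀ (by positivity) (by linarith) _
        have h6 : (s : ℝ) ≤ s ^ m := le_self_pow₀ hs' (by omega)
        have h7 : (0 : ℝ) ≤ n * p ^ m := by positivity
        calc s * l / 2 ≤ s * l ^ 2 := by
              rw [mul_div_assoc]
              gcongr
              nlinarith
          _ ≤ s * (n * p ^ m) := by gcongr
          _ ≤ s ^ m * (n * p ^ m) := by gcongr
          _ = (s * p : ℝ) ^ m * n := by rw [mul_pow]; ring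
          _ ≤ _ := by gcongr
      · rw [min_eq_right h1] at hqmin
        have h5 : (1 : ℝ) ≤ (2 * q) ^ m := one_le_pow₀ (by linarith)
        nlinarith
    rw [← h2] at h3
    exact le_of_mul_le_mul_left h3 (by positivity)
  have hq0 : 0 ≤ q := by
    have : (0 : ℝ) ≤ min (s * (p : ℝ)) 1 := le_min (by positivity) zero_le_one
    linarith
  have hqm0 : 0 ≤ q ^ m := pow_nonneg hq0 m
  have hqm1 : q ^ m ≤ 1 := pow_le_one₀ hq0 hq1
  refine (binomialRandom_exists_ncard_commonNbhd_le p m (s := s) (by nlinarith)).trans ?_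
  rw [← hn, ← hq]
  have e1 : (n : ℝ) ^ (s * (m + 1)) = Real.exp (s * (m + 1) * L) := by
    rw [hL, ← Real.exp_log hn0, ← Real.exp_nat_mul, Real.exp_log hn0]
    push_cast
    rfl
  have e2 : (1 - q ^ m) ^ (n - (m + 1) * s) ≤ Real.exp (-(q ^ m * (n / 2))) := by
    calc (1 - q ^ m) ^ (n - (m + 1) * s) ≤ Real.exp (-q ^ m) ^ (n - (m + 1) * s) :=
          pow_le_pow_left₀ (by linarith) (Real.one_sub_le_exp_neg _) _
      _ = Real.exp (-(q ^ m * ((n - (m + 1) * s : ℕ) : ℝ))) := by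
          rw [← Real.exp_nat_mul]; ring_nf
      _ ≤ _ := by
          refine Real.exp_le_exp.2 (neg_le_neg (mul_le_mul_of_nonneg_left ?_ hqm0))
          rw [Nat.cast_sub hsn']
          push_cast
          linarith
  rw [e1]
  refine (mul_le_mul_of_nonneg_left e2 (Real.exp_pos _).le).trans ?_
  rw [← Real.exp_add]
  refine Real.exp_le_exp.2 ?_
  nlinarith

/-- The failure probability of the expansion at sets of size `s`, for large `s`. -/
theorem binomialRandom_large_sets_le {V : Type*} [Fintype V] (p : unitInterval) {m : ℕ}
    {L l : ℝ} (hL : L = Real.log (Fintype.card V)) (hL1 : 1 ≤ L) (hl : l = 2 ^ (m + 2) * (m + 3) * L)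
    (hp : l ^ 2 ≤ Fintype.card V * (p : ℝ) ^ m) (hm : 1 ≤ m) {s : ℕ} (hsV : s < Fintype.card V)
    (hsl : Fintype.card V < s * l) :
    (SimpleGraph.binomialRandom V p).real {G | ∃ S : Fin m → Finset V, (∀ i, (S i).card = s) ∧
        (commonNbhd G fun i => (S i : Set V)).ncard ≤ s} ≤ Real.exp (-(2 * L)) := by
  set n := Fintype.card V with hn
  have hp0 : (0 : ℝ) ≤ p := p.2.1
  have hp1 : (p : ℝ) ≤ 1 := p.2.2
  have hn0 : (0 : ℝ) < n := by
    have : 0 < n := by omega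
    exact_mod_cast this
  have hpow : (1 : ℝ) ≤ 2 ^ m := one_le_pow₀ (by norm_num)
  have hlm : 4 * (m + 3) * L ≤ l := by
    have : (4 : ℝ) ≤ 2 ^ (m + 2) := by rw [pow_add]; linarith
    rw [hl]
    gcongr
  have hm0 : (0 : ℝ) ≤ m := by positivity
  have hl2 : 2 ≤ l := by nlinarith
  -- As `p ^ m ≤ p`, `l ^ 2 ≤ n * p`; now use `n < s * l`.
  have hsp : l ≤ p * s := by
    have h1 : (p : ℝ) ^ m ≤ p := pow_le_of_le_one hp0 hp1 (by omega)
    have h2 : l * l ≤ (p * s) * l := by nlinarith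
    exact le_of_mul_le_mul_right h2 (by linarith)
  have hs2 : 2 ≤ s := by
    have : (2 : ℝ) ≤ s := by nlinarith [Nat.cast_nonneg (α := ℝ) s]
    exact_mod_cast this
  -- `t` is `(n - s) / m` rounded up: small enough for the pigeonhole, large enough that `n ^ (m *
  -- t)` bounds the choices of an `s`-set through its complement.
  obtain ⟨t, ht1, htm, hmt⟩ : ∃ t, 1 ≤ t ∧ n - s ≤ m * t ∧ m * (t - 1) + s < n := by
    refine ⟨(n - s - 1) / m + 1, Nat.le_add_left _ _, ?_, ?_⟩
    · have := Nat.lt_div_mul_add (a := n - s - 1) (b := m) (by omega)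
      rw [mul_add, mul_comm m, mul_one]
      omega
    · have := Nat.div_mul_le_self (n - s - 1) m
      rw [Nat.add_sub_cancel, mul_comm]
      omega
  have ht1' : (1 : ℝ) ≤ t := by exact_mod_cast ht1
  have hsub : {G : SimpleGraph V | ∃ S : Fin m → Finset V, (∀ i, (S i).card = s) ∧
      (commonNbhd G fun i => (S i : Set V)).ncard ≤ s} ⊆
      {G | ∃ S T : Finset V, S.card = s ∧ T.card = t ∧ ∀ x ∈ S, ∀ y ∈ T, ¬ G.Adj x y} :=
    fun G ⟨S, hS, hG⟩ => exists_no_edges_of_ncard_commonNbhd_le hS hG hmt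
  refine (MeasureTheory.measureReal_mono hsub (MeasureTheory.measure_ne_top _ _)).trans ?_
  refine (binomialRandom_exists_no_edges_le p hs2 t).trans ?_
  rw [← hn]
  have hchoose : (n.choose s : ℝ) ≤ (n : ℝ) ^ (m * t) := by
    have : n.choose s ≤ n ^ (m * t) := by
      rw [← Nat.choose_symm hsV.le]
      exact (Nat.choose_le_pow _ _).trans (Nat.pow_le_pow_right (by omega) htm)
    exact_mod_cast this
  have e1 : (n : ℝ) ^ (m * t) * (n : ℝ) ^ t = Real.exp ((m + 1) * t * L) := by
    rw [hL, ← pow_add, ← Real.exp_log hn0, ← Real.exp_nat_mul, Real.exp_log hn0]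
    push_cast
    ring_nf
  calc (n.choose s : ℝ) * (n : ℝ) ^ t * Real.exp (-(p * s * t / 4))
      ≤ (n : ℝ) ^ (m * t) * (n : ℝ) ^ t * Real.exp (-(p * s * t / 4)) := by gcongr
    _ = Real.exp ((m + 1) * t * L + -(p * s * t / 4)) := by rw [e1, ← Real.exp_add]
    _ ≤ Real.exp (-(2 * L)) := by
      refine Real.exp_le_exp.2 ?_
      have h1 : 4 * (m + 3) * L * t ≤ p * s * t :=
        mul_le_mul_of_nonneg_right (hlm.trans hsp) (by linarith)
      nlinarith

theorem binomialRandom_not_isExpanding_le {V : Type*} [Fintype V] (p : unitInterval) {m : ℕ}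
    {L : ℝ} (hL : L = Real.log (Fintype.card V)) (hL1 : 1 ≤ L)
    (hp : (2 ^ (m + 2) * (m + 3) * L) ^ 2 ≤ Fintype.card V * (p : ℝ) ^ m) (hm : 1 ≤ m) :
    (SimpleGraph.binomialRandom V p).real {G | ¬ IsExpanding G m} ≤ 1 / Fintype.card V := by
  set n := Fintype.card V with hn
  have hn0 : (0 : ℝ) < n := by
    refine Nat.cast_pos.2 (Nat.pos_of_ne_zero fun h => ?_)
    rw [h, Nat.cast_zero, Real.log_zero] at hL
    linarith
  have hsub : {G : SimpleGraph V | ¬ IsExpanding G m} ⊆ ⋃ s ∈ Finset.Ico 1 n,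
      {G | ∃ S : Fin m → Finset V, (∀ i, (S i).card = s) ∧
        (commonNbhd G fun i => (S i : Set V)).ncard ≤ s} := by
    intro G hG
    simp only [IsExpanding, Set.mem_ofPred_eq] at hG
    push Not at hG
    obtain ⟨s, hs, hsV, S, hS, hle⟩ := hG
    rw [Nat.card_eq_fintype_card] at hsV
    simp only [Set.mem_iUnion]
    exact ⟨s, Finset.mem_Ico.2 ⟨hs, hsV⟩, S, hS, hle⟩
  refine (MeasureTheory.measureReal_mono hsub (MeasureTheory.measure_ne_top _ _)).trans ?_
  refine (MeasureTheory.measureReal_biUnion_finset_le _ _).trans ?_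
  refine (Finset.sum_le_card_nsmul _ _ (Real.exp (-(2 * L))) fun s hs => ?_).trans ?_
  · obtain ⟨hs1, hsn⟩ := Finset.mem_Ico.1 hs
    rcases le_or_gt (s * (2 ^ (m + 2) * (m + 3) * L)) n with h | h
    · exact binomialRandom_small_sets_le p hL hL1 rfl hp hm hs1 h
    · exact binomialRandom_large_sets_le p hL hL1 rfl hp hm hsn h
  · have e : Real.exp (-(2 * L)) = 1 / n * (1 / n) := by
      rw [show -(2 * L) = -L + -L by ring, Real.exp_add, Real.exp_neg, hL, Real.exp_log hn0,
        one_div]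
    rw [Nat.card_Ico, nsmul_eq_mul, e, ← mul_assoc]
    refine mul_le_of_le_one_left (by positivity) ?_
    rw [mul_one_div, div_le_one hn0]
    exact_mod_cast Nat.sub_le n 1

/-! ### Asymptotics and conclusion -/

/-- Up to a constant, `n * p ^ m` is at least `n ^ (1 - m * α)`, a positive power of `n`. -/
theorem eventually_sq_log_le_mul_pow {α : ℝ} {m : ℕ} (hmα : m * α < 1) {p : ℕ → ℝ}
    (hp0 : ∀ n, 0 ≤ p n) (hp : (fun n : ℕ => (n : ℝ) ^ (-α)) =O[atTop] p) (K : ℝ) :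
    ∀ᶠ n : ℕ in atTop, (K * Real.log n) ^ 2 ≤ n * p n ^ m := by
  obtain ⟨C, hC0, hC⟩ := hp.exists_pos
  rw [IsBigOWith] at hC
  have hlog : (fun n : ℕ => (K * Real.log n) ^ 2) =o[atTop]
      fun n : ℕ => (n : ℝ) ^ (1 - m * α) := by
    have h1 := (isLittleO_log_rpow_atTop (r := (1 - m * α) / 2) (by linarith)).const_mul_left K
    have h2 := (h1.comp_tendsto tendsto_natCast_atTop_atTop).pow (n := 2) (by norm_num)
    refine h2.congr' (.of_forall fun n => rfl) (.of_forall fun n => ?_)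
    simp only [Function.comp_apply]
    rw [← Real.rpow_mul_natCast (Nat.cast_nonneg n)]
    congr 1
    push_cast
    ring
  filter_upwards [hC, hlog.bound (show 0 < (C ^ m)⁻¹ by positivity), eventually_gt_atTop 0]
    with n hn1 hn2 hn0
  have hn0' : (0 : ℝ) < n := by exact_mod_cast hn0
  rw [Real.norm_of_nonneg (by positivity), Real.norm_of_nonneg (hp0 n)] at hn1
  rw [Real.norm_of_nonneg (by positivity), Real.norm_of_nonneg (by positivity)] at hn2
  refine hn2.trans ?_
  have h3 : ((n : ℝ) ^ (-α)) ^ m ≤ (C * p n) ^ m := pow_le_pow_left₀ (by positivity) hn1 m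
  have h4 : (n : ℝ) ^ (1 - m * α) = n * ((n : ℝ) ^ (-α)) ^ m := by
    rw [← Real.rpow_mul_natCast hn0'.le, sub_eq_add_neg, Real.rpow_add hn0', Real.rpow_one]
    ring_nf
  rw [inv_mul_le_iff₀ (by positivity), h4, ← mul_left_comm, ← mul_pow]
  gcongr

theorem theorem3p3 (α : ℝ) (hα : 0 < α) (p : ℕ → unitInterval)
    (hp : (fun n : ℕ => (n : ℝ) ^ (-α)) =O[atTop] (fun n : ℕ => (p n : ℝ))) :
    Tendsto
      (fun n : ℕ => SimpleGraph.binomialRandom (Fin n) (p n)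
        {G : SimpleGraph (Fin n) | ((⌈1 / α + 1⌉₊ : ℕ) : ℕ∞) ≤ warmth G})
      atTop (nhds 1) := by
  have hα' : 0 < 1 / α := by positivity
  obtain ⟨m, hm⟩ : ∃ m, ⌈1 / α + 1⌉₊ = m + 2 := by
    refine ⟨⌈1 / α + 1⌉₊ - 2, ?_⟩
    have : 1 < ⌈1 / α + 1⌉₊ := Nat.lt_ceil.2 (by push_cast; linarith)
    omega
  rw [hm]
  rcases Nat.eq_zero_or_pos m with rfl | hm0
  -- For `m = 0` the bound is 2, which holds for every graph; the expansion estimate requires `m ≥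
  -- 1`.
  · refine tendsto_const_nhds.congr fun n => ?_
    have huniv : {G : SimpleGraph (Fin n) | ((0 + 2 : ℕ) : ℕ∞) ≤ warmth G} = Set.univ :=
      Set.eq_univ_of_forall fun G => (isWarm_two G).le_warmth
    rw [huniv, MeasureTheory.measure_univ]
  -- Strictness comes from the ceiling: `m + 1` is below it, hence below `1 / α + 1`.
  have hmα : m * α < 1 := by
    have h1 : ((m + 1 : ℕ) : ℝ) < 1 / α + 1 := Nat.lt_ceil.1 (by omega)
    push_cast at h1
    rw [← lt_div_iff₀ hα]
    linarith
  have hreal : Tendsto (fun n : ℕ => (SimpleGraph.binomialRandom (Fin n) (p n)).real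
      {G : SimpleGraph (Fin n) | ((m + 2 : ℕ) : ℕ∞) ≤ warmth G}) atTop (nhds 1) := by
    have hlow : Tendsto (fun n : ℕ => 1 - 1 / (n : ℝ)) atTop (nhds 1) := by
      simpa using (tendsto_one_div_atTop_nhds_zero_nat (𝕜 := ℝ)).const_sub 1
    refine tendsto_of_tendsto_of_tendsto_of_le_of_le' hlow tendsto_const_nhds ?_
      (.of_forall fun n => MeasureTheory.measureReal_le_one)
    filter_upwards [eventually_sq_log_le_mul_pow hmα (fun n => (p n).2.1) hp (2 ^ (m + 2) * (m + 3)),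
      (Real.tendsto_log_atTop.comp tendsto_natCast_atTop_atTop).eventually_ge_atTop 1,
      eventually_ge_atTop 2] with n hn hlog hn2
    have hbad := binomialRandom_not_isExpanding_le (V := Fin n) (p n) rfl (by simpa using hlog)
      (by simpa using hn) hm0
    rw [Fintype.card_fin] at hbad
    have hcompl := MeasureTheory.probReal_compl_eq_one_sub
      (μ := SimpleGraph.binomialRandom (Fin n) (p n))
      (measurableSet_simpleGraph {G | ¬ IsExpanding G m})
    refine le_trans (by linarith) (MeasureTheory.measureReal_mono (μ := SimpleGraph.binomialRandom (Fin n) (p n))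
      (s₁ := {G | ¬ IsExpanding G m}ᶜ) (fun G hG => ?_) (MeasureTheory.measure_ne_top _ _))
    exact ((not_not.1 hG : IsExpanding G m).isWarm (by simpa using hn2)).le_warmth
  simpa [MeasureTheory.measureReal_def] using ENNReal.tendsto_ofReal hreal
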